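/- Let $\mathbf S=(S(t))_{t\ge 0}$ be a strongly continuous semigroup of bounded linear operators on a complex Banach space $X$, with generator $A$ and domain $D(A)$. Fix $\lambda\in\rho(A)$, let $R(\lambda,A)=(\lambda-A)^{-1}$, and let $X_{-1}\supset X$ be the completion of $X$ with respect to the norm $\|R(\lambda,A)\,\cdot\,\|$. Let $\mathbf S_{-1}=(S_{-1}(t))_{t\ge 0}$ be the extension of $\mathbf S$ to a strongly continuous semigroup on $X_{-1}$, and let $A_{-1}\in\mathcal L(X,X_{-1})$ be its generator, whose domain is $X$. Assume that $A_{-1}$ is $L^\infty$-admissible for $\mathbf S$, that is, for some $\tau>0$, $$\int_0^\tau S_{-1}(\tau-t)A_{-1}u(t)\,dt\in X\qquad\text{for all } u\in L^\infty([0,\tau],X),$$ where the integral is a Bochner integral in $X_{-1}$. Then $$\Bigl\{x\in X:\ \limsup_{t\to 0^+}\tfrac1t\|S(t)x-x\|<\infty\Bigr\}=D(A),$$ that is, the Favard space of $\mathbf S$ equals $D(A)$. -/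

import Mathlib

open Filter Topology MeasureTheory
open scoped NNReal ENNReal

noncomputable section

/-- A strongly continuous one-parameter semigroup `(S(t))_{t ≥ 0}` of bounded linear operators on a
complex normed space `X`. -/
structure C0Semigroup (X : Type*) [NormedAddCommGroup X] [NormedSpace ℂ X] where
  /-- The operators of the semigroup. -/
  op : ℝ≥0 → X →L[ℂ] X
  op_zero : op 0 = ContinuousLinearMap.id ℂ X
  op_add : ∀ s t : ℝ≥0, op (s + t) = (op s).comp (op t)
  tendsto_zero : ∀ x : X, Tendsto (fun t : ℝ≥0 => op t x) (𝓝 0) (𝓝 x)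

namespace C0Semigroup

variable {X : Type*} [NormedAddCommGroup X] [NormedSpace ℂ X]

/-- The difference quotient `(S(t)x - x) / t`. -/
def quot (S : C0Semigroup X) (x : X) (t : ℝ≥0) : X :=
  ((t : ℝ) : ℂ)⁻¹ • (S.op t x - x)

theorem quot_add (S : C0Semigroup X) (x y : X) (t : ℝ≥0) :
    S.quot (x + y) t = S.quot x t + S.quot y t := by
  simp only [quot, map_add, ← smul_add]
  congr 1
  abel

theorem quot_smul (S : C0Semigroup X) (c : ℂ) (x : X) (t : ℝ≥0) :
    S.quot (c • x) t = c • S.quot x t := by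
  simp only [quot, map_smul, ← smul_sub, smul_comm c]

/-- The domain `D(A)` of the generator: all `x` for which `(S(t)x - x) / t` converges as
`t → 0+`. -/
def generatorDomain (S : C0Semigroup X) : Submodule ℂ X where
  carrier := {x | ∃ y, Tendsto (S.quot x) (𝓝[>] 0) (𝓝 y)}
  zero_mem' := ⟨0, tendsto_const_nhds.congr fun t => by simp [quot]⟩
  add_mem' := by
    rintro x y ⟨a, ha⟩ ⟨b, hb⟩
    exact ⟨a + b, (ha.add hb).congr fun t => (S.quot_add x y t).symm⟩
  smul_mem' := by
    rintro c x ⟨a, ha⟩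
    exact ⟨c • a, (ha.const_smul c).congr fun t => (S.quot_smul c x t).symm⟩

theorem tendsto_choose (S : C0Semigroup X) (x : S.generatorDomain) :
    Tendsto (S.quot x) (𝓝[>] 0) (𝓝 x.2.choose) := x.2.choose_spec

/-- The generator `A` of the semigroup, `A x = lim_{t → 0+} (S(t)x - x) / t`, as an unbounded
operator with domain `D(A)`. -/
def generator (S : C0Semigroup X) : X →ₗ.[ℂ] X where
  domain := S.generatorDomain
  toFun :=
    { toFun := fun x => x.2.choose
      map_add' := fun x y => tendsto_nhds_unique (S.tendsto_choose (x + y))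
        (((S.tendsto_choose x).add (S.tendsto_choose y)).congr
          fun t => (S.quot_add x y t).symm)
      map_smul' := fun c x => tendsto_nhds_unique (S.tendsto_choose (c • x))
        (((S.tendsto_choose x).const_smul c).congr fun t => (S.quot_smul c x t).symm) }

theorem tendsto_generator (S : C0Semigroup X) (x : S.generator.domain) :
    Tendsto (S.quot x) (𝓝[>] 0) (𝓝 (S.generator x)) := S.tendsto_choose x

theorem generator_eq (S : C0Semigroup X) {x y : X} (h : Tendsto (S.quot x) (𝓝[>] 0) (𝓝 y)) :
    S.generator ⟨x, y, h⟩ = y :=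
  tendsto_nhds_unique (S.tendsto_generator ⟨x, y, h⟩) h

/-- `R` is a bounded two-sided inverse of `λ - A : D(A) → X`. -/
def IsResolvent (S : C0Semigroup X) (lam : ℂ) (R : X →L[ℂ] X) : Prop :=
  (∀ x : X, ∃ h : R x ∈ S.generator.domain, lam • R x - S.generator ⟨R x, h⟩ = x) ∧
    ∀ x : S.generator.domain, R (lam • (x : X) - S.generator x) = x

/-- The resolvent set `ρ(A)` of the generator. -/
def resolventSet (S : C0Semigroup X) : Set ℂ :=
  {lam | ∃ R : X →L[ℂ] X, S.IsResolvent lam R}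

/-- The resolvent operator `R(λ, A) = (λ - A)⁻¹` for `λ ∈ ρ(A)`. -/
def resolvent (S : C0Semigroup X) (lam : S.resolventSet) : X →L[ℂ] X := lam.2.choose

theorem isResolvent (S : C0Semigroup X) (lam : S.resolventSet) :
    S.IsResolvent lam (S.resolvent lam) := lam.2.choose_spec

theorem resolvent_injective (S : C0Semigroup X) (lam : S.resolventSet) :
    Function.Injective (S.resolvent lam) := by
  intro x y hxy
  obtain ⟨h1, h2⟩ := (S.isResolvent lam).1 x
  obtain ⟨h3, h4⟩ := (S.isResolvent lam).1 y
  rw [← h2, ← h4]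
  simp only [hxy]

theorem op_comm (S : C0Semigroup X) (s t : ℝ≥0) (x : X) :
    S.op s (S.op t x) = S.op t (S.op s x) := by
  have h := S.op_add s t
  rw [add_comm, S.op_add t s] at h
  exact (DFunLike.congr_fun h x).symm

theorem tendsto_quot_op (S : C0Semigroup X) (t : ℝ≥0) (x : S.generator.domain) :
    Tendsto (S.quot (S.op t x)) (𝓝[>] 0) (𝓝 (S.op t (S.generator x))) := by
  refine (((S.op t).continuous.tendsto _).comp (S.tendsto_generator x)).congr fun s => ?_
  simp only [quot, Function.comp_apply, map_smul, map_sub, S.op_comm s t]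

theorem resolvent_op (S : C0Semigroup X) (lam : S.resolventSet) (t : ℝ≥0) (x : X) :
    S.resolvent lam (S.op t x) = S.op t (S.resolvent lam x) := by
  obtain ⟨h1, h2⟩ := (S.isResolvent lam).1 x
  have h3 := S.tendsto_quot_op t ⟨_, h1⟩
  have h4 := (S.isResolvent lam).2 ⟨S.op t (S.resolvent lam x), _, h3⟩
  rw [S.generator_eq h3] at h4
  change S.resolvent lam (_ - _) = S.op t (S.resolvent lam x) at h4
  rw [← h4]
  change _ = S.resolvent lam ((lam : ℂ) • S.op t (S.resolvent lam x) - _)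
  rw [← map_smul, ← map_sub, h2]

theorem eventually_norm_op_le [CompleteSpace X] (S : C0Semigroup X) :
    ∃ M : ℝ, ∀ᶠ t in 𝓝 (0 : ℝ≥0), ‖S.op t‖ ≤ M := by
  by_contra! hcon
  have h1 : ∀ n : ℕ, ∃ t : ℝ≥0, t < 1 / ((n : ℝ≥0) + 1) ∧ (n : ℝ) < ‖S.op t‖ := by
    intro n
    have h2 : ∀ᶠ t in 𝓝 (0 : ℝ≥0), t < 1 / ((n : ℝ≥0) + 1) :=
      eventually_lt_nhds (by positivity)
    have h3 : ∃ᶠ t in 𝓝 (0 : ℝ≥0), (n : ℝ) < ‖S.op t‖ := by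
      simpa [Filter.not_eventually] using hcon n
    obtain ⟨t, h4, h5⟩ := (h3.and_eventually h2).exists
    exact ⟨t, h5, h4⟩
  choose t ht1 ht2 using h1
  have ht : Tendsto t atTop (𝓝 0) :=
    tendsto_of_tendsto_of_tendsto_of_le_of_le tendsto_const_nhds
      tendsto_one_div_add_atTop_nhds_zero_nat (fun n => (t n).2) (fun n => (ht1 n).le)
  obtain ⟨C, hC⟩ := banach_steinhaus (g := fun n => S.op (t n)) fun x => by
    obtain ⟨C, hC⟩ := (((S.tendsto_zero x).comp ht).norm).bddAbove_range
    exact ⟨C, fun n => hC ⟨n, rfl⟩⟩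
  obtain ⟨n, hn⟩ := exists_nat_gt C
  exact absurd (hC n) (by linarith [ht2 n])

/-- A copy of `X`, to be equipped with the norm `x ↦ ‖R(λ, A) x‖`. -/
def WeakCopy (_S : C0Semigroup X) (_lam : _S.resolventSet) : Type _ := X

instance (S : C0Semigroup X) (lam : S.resolventSet) : AddCommGroup (S.WeakCopy lam) :=
  inferInstanceAs (AddCommGroup X)

instance (S : C0Semigroup X) (lam : S.resolventSet) : Module ℂ (S.WeakCopy lam) :=
  inferInstanceAs (Module ℂ X)

/-- The identity `X → WeakCopy`. -/
def toWeak (S : C0Semigroup X) (lam : S.resolventSet) : X ≃ₗ[ℂ] S.WeakCopy lam :=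
  LinearEquiv.refl ℂ X

/-- The resolvent as a map on `WeakCopy`. -/
def weakResolvent (S : C0Semigroup X) (lam : S.resolventSet) : S.WeakCopy lam →ₗ[ℂ] X :=
  (S.resolvent lam : X →ₗ[ℂ] X) ∘ₗ ((S.toWeak lam).symm : S.WeakCopy lam →ₗ[ℂ] X)

instance (S : C0Semigroup X) (lam : S.resolventSet) : NormedAddCommGroup (S.WeakCopy lam) :=
  NormedAddCommGroup.induced _ _ (S.weakResolvent lam)
    ((S.resolvent_injective lam).comp (S.toWeak lam).symm.injective)

instance (S : C0Semigroup X) (lam : S.resolventSet) : NormedSpace ℂ (S.WeakCopy lam) :=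
  NormedSpace.induced ℂ _ _ (S.weakResolvent lam)

theorem norm_toWeak (S : C0Semigroup X) (lam : S.resolventSet) (x : X) :
    ‖S.toWeak lam x‖ = ‖S.resolvent lam x‖ := rfl

/-- The extrapolation space `X₋₁`: the completion of `X` with respect to the norm
`‖R(λ, A) ·‖`. -/
abbrev ExtrapolationSpace (S : C0Semigroup X) (lam : S.resolventSet) : Type _ :=
  UniformSpace.Completion (S.WeakCopy lam)

/-- The canonical embedding of `X` into `X₋₁`. -/
def embed (S : C0Semigroup X) (lam : S.resolventSet) : X →L[ℂ] S.ExtrapolationSpace lam :=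
  LinearMap.mkContinuous
    ((UniformSpace.Completion.toComplₗᵢ (𝕜 := ℂ) (E := S.WeakCopy lam)).toLinearMap ∘ₗ
      (S.toWeak lam : X →ₗ[ℂ] S.WeakCopy lam)) ‖S.resolvent lam‖ fun x => by
    simpa [norm_toWeak] using (S.resolvent lam).le_opNorm x

theorem embed_apply (S : C0Semigroup X) (lam : S.resolventSet) (x : X) :
    S.embed lam x = ((S.toWeak lam x : S.WeakCopy lam) : S.ExtrapolationSpace lam) := rfl

theorem norm_embed (S : C0Semigroup X) (lam : S.resolventSet) (x : X) :
    ‖S.embed lam x‖ = ‖S.resolvent lam x‖ := by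
  rw [embed_apply, UniformSpace.Completion.norm_coe, norm_toWeak]

theorem denseRange_embed (S : C0Semigroup X) (lam : S.resolventSet) :
    DenseRange (S.embed lam) :=
  UniformSpace.Completion.denseRange_coe.comp (S.toWeak lam).surjective.denseRange
    (UniformSpace.Completion.continuous_coe _)

/-- `S(t)` as a bounded operator for the norm `‖R(λ, A) ·‖`. -/
def weakOp (S : C0Semigroup X) (lam : S.resolventSet) (t : ℝ≥0) :
    S.WeakCopy lam →L[ℂ] S.WeakCopy lam :=
  LinearMap.mkContinuous
    ((S.toWeak lam : X →ₗ[ℂ] S.WeakCopy lam) ∘ₗ (S.op t : X →ₗ[ℂ] X) ∘ₗ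
      ((S.toWeak lam).symm : S.WeakCopy lam →ₗ[ℂ] X)) ‖S.op t‖ fun x => by
    obtain ⟨x, rfl⟩ := (S.toWeak lam).surjective x
    simpa [norm_toWeak, resolvent_op] using (S.op t).le_opNorm (S.resolvent lam x)

/-- The extension of `S(t)` to a bounded operator on `X₋₁`. -/
def extrapolatedOp (S : C0Semigroup X) (lam : S.resolventSet) (t : ℝ≥0) :
    S.ExtrapolationSpace lam →L[ℂ] S.ExtrapolationSpace lam :=
  (S.weakOp lam t).completion

theorem extrapolatedOp_embed (S : C0Semigroup X) (lam : S.resolventSet) (t : ℝ≥0) (x : X) :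
    S.extrapolatedOp lam t (S.embed lam x) = S.embed lam (S.op t x) := by
  rw [embed_apply, extrapolatedOp, ContinuousLinearMap.completion_apply_coe]
  rfl

theorem norm_extrapolatedOp_le (S : C0Semigroup X) (lam : S.resolventSet) (t : ℝ≥0)
    (z : S.ExtrapolationSpace lam) : ‖S.extrapolatedOp lam t z‖ ≤ ‖S.op t‖ * ‖z‖ := by
  induction z using (S.denseRange_embed lam).induction_on with
  | hp => exact isClosed_le (by fun_prop) (by fun_prop)
  | ih x =>
    rw [extrapolatedOp_embed, norm_embed, norm_embed, resolvent_op]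
    exact (S.op t).le_opNorm _

theorem tendsto_resolvent_quot (S : C0Semigroup X) (lam : S.resolventSet) (x : X) :
    Tendsto (fun t => S.resolvent lam (S.quot x t)) (𝓝[>] 0)
      (𝓝 ((lam : ℂ) • S.resolvent lam x - x)) := by
  obtain ⟨h1, h2⟩ := (S.isResolvent lam).1 x
  have h3 := S.tendsto_generator ⟨_, h1⟩
  have h4 : S.generator ⟨_, h1⟩ = (lam : ℂ) • S.resolvent lam x - x := by
    rw [eq_sub_iff_add_eq, ← eq_sub_iff_add_eq', h2]
  rw [h4] at h3
  exact h3.congr fun t => by simp only [quot, map_smul, map_sub, resolvent_op]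

variable [CompleteSpace X]

/-- The extrapolated semigroup `S₋₁`: the extension of `S` to `X₋₁`. -/
def extrapolated (S : C0Semigroup X) (lam : S.resolventSet) :
    C0Semigroup (S.ExtrapolationSpace lam) where
  op := S.extrapolatedOp lam
  op_zero := by
    ext z
    induction z using (S.denseRange_embed lam).induction_on with
    | hp => exact isClosed_eq (by fun_prop) (by fun_prop)
    | ih x => simp [extrapolatedOp_embed, S.op_zero]
  op_add s t := by
    ext z
    induction z using (S.denseRange_embed lam).induction_on with
    | hp => exact isClosed_eq (by fun_prop) (by fun_prop)
    | ih x => simp [extrapolatedOp_embed, S.op_add]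
  tendsto_zero z := by
    obtain ⟨M, hM⟩ := S.eventually_norm_op_le
    rw [Metric.tendsto_nhds]
    intro ε hε
    have hM0 : 0 ≤ M := by
      obtain ⟨t, ht⟩ := hM.exists
      exact (norm_nonneg _).trans ht
    obtain ⟨y, ⟨x, rfl⟩, hx⟩ := Metric.mem_closure_iff.1 (S.denseRange_embed lam z)
      (ε / (2 * (M + 1))) (by positivity)
    have hx' : (M + 1) * ‖z - S.embed lam x‖ < ε / 2 := by
      rw [dist_eq_norm, lt_div_iff₀ (by positivity)] at hx
      linarith
    have h1 := Metric.tendsto_nhds.1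
      (((S.embed lam).continuous.tendsto x).comp (S.tendsto_zero x)) (ε / 2) (by positivity)
    filter_upwards [hM, h1] with t ht ht1
    rw [dist_eq_norm] at ht1 ⊢
    have h2 := S.norm_extrapolatedOp_le lam t (z - S.embed lam x)
    have h3 : ‖S.op t‖ * ‖z - S.embed lam x‖ ≤ M * ‖z - S.embed lam x‖ := by gcongr
    have h4 : S.extrapolatedOp lam t z - z = S.extrapolatedOp lam t (z - S.embed lam x) +
        (S.embed lam (S.op t x) - S.embed lam x) - (z - S.embed lam x) := by
      rw [map_sub, extrapolatedOp_embed]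
      abel
    rw [h4]
    refine (norm_sub_le _ _).trans_lt ?_
    have h5 := norm_add_le (S.extrapolatedOp lam t (z - S.embed lam x))
      (S.embed lam (S.op t x) - S.embed lam x)
    simp only [Function.comp_apply] at ht1
    linarith

theorem extrapolated_quot (S : C0Semigroup X) (lam : S.resolventSet) (x : X) (t : ℝ≥0) :
    (S.extrapolated lam).quot (S.embed lam x) t = S.embed lam (S.quot x t) := by
  simp only [quot, map_smul, map_sub, ← extrapolatedOp_embed]
  rfl

/-- `X` is contained in the domain of the generator of the extrapolated semigroup. -/
theorem embed_mem_domain (S : C0Semigroup X) (lam : S.resolventSet) (x : X) :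
    S.embed lam x ∈ (S.extrapolated lam).generator.domain := by
  have h1 := (S.tendsto_resolvent_quot lam x).cauchy_map
  have h2 : Cauchy (map (fun t => S.embed lam (S.quot x t)) (𝓝[>] 0)) := by
    rw [Metric.cauchy_iff] at h1 ⊢
    refine ⟨inferInstance, fun ε hε => ?_⟩
    obtain ⟨s, hs, hs'⟩ := h1.2 ε hε
    refine ⟨_, image_mem_map (mem_map.1 hs), ?_⟩
    rintro _ ⟨t, ht, rfl⟩ _ ⟨r, hr, rfl⟩
    have h3 := hs' _ ht _ hr
    rw [dist_eq_norm, ← map_sub] at h3 ⊢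
    rwa [norm_embed]
  obtain ⟨z, hz⟩ := CompleteSpace.complete h2
  exact ⟨z, Tendsto.congr (fun t => (S.extrapolated_quot lam x t).symm) hz⟩

/-- The operator `A₋₁`, the generator of the extrapolated semigroup `S₋₁`, as a bounded operator
from `X` to `X₋₁`. -/
def extrapolatedGenerator (S : C0Semigroup X) (lam : S.resolventSet) :
    X →L[ℂ] S.ExtrapolationSpace lam :=
  LinearMap.mkContinuous
    ((S.extrapolated lam).generator.toFun ∘ₗ
      (S.embed lam : X →ₗ[ℂ] S.ExtrapolationSpace lam).codRestrict
        (S.extrapolated lam).generator.domain (S.embed_mem_domain lam))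
    (‖(lam : ℂ)‖ * ‖S.resolvent lam‖ + 1) fun x => by
    have h1 := ((S.extrapolated lam).tendsto_generator ⟨_, S.embed_mem_domain lam x⟩).norm
    have h2 := (S.tendsto_resolvent_quot lam x).norm
    simp only [extrapolated_quot, norm_embed] at h1
    refine (tendsto_nhds_unique h1 h2).trans_le ((norm_sub_le _ _).trans ?_)
    rw [norm_smul, add_mul, one_mul, mul_assoc]
    gcongr
    exact (S.resolvent lam).le_opNorm x

/-- `B ∈ L(U, X₋₁)` is an `L^∞`-admissible control operator: for some `τ > 0`, the integral
`∫_0^τ S₋₁(τ - t) B u(t) dt`, taken in `X₋₁`, lies in `X` for every `u ∈ L^∞([0, τ], U)`. -/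
def IsLinftyAdmissible (S : C0Semigroup X) (lam : S.resolventSet) {U : Type*}
    [NormedAddCommGroup U] [NormedSpace ℂ U] (B : U →L[ℂ] S.ExtrapolationSpace lam) : Prop :=
  ∃ τ : ℝ, 0 < τ ∧ ∀ u : ℝ → U, MemLp u ∞ (volume.restrict (Set.Icc 0 τ)) →
    (∫ t in (0 : ℝ)..τ, (S.extrapolated lam).op (τ - t).toNNReal (B (u t))) ∈
      Set.range (S.embed lam)

/-- The Favard space of the semigroup. -/
def favardSpace (S : C0Semigroup X) : Set X :=
  {x | limsup (fun t : ℝ≥0 => ENNReal.ofReal (‖S.op t x - x‖ / (t : ℝ))) (𝓝[>] 0) < ∞}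

end C0Semigroup

end

noncomputable section

namespace C0Semigroup

/-! ### Orbits, their averages, and the domain of the generator. -/

section Averages

variable {X : Type*} [NormedAddCommGroup X] [NormedSpace ℂ X]

/-! Admissibility of `A₋₁` forces `S` to be norm continuous at `0`, hence `D(A) = X`. The inclusion
of `D(A)` in the Favard space always holds, and the converse is then trivial.

View the unit ball of `L^∞` as a closed subset `W` of `L¹`. Admissibility gives a map `z : W → X`,
the control integral, which is only known to be continuous into `X₋₁`. The averages `h⁻¹ ∫_0^h S(s)
ds` are bounded from the `X₋₁` norm to that of `X`, so `z` is a pointwise limit of continuous maps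
into `X`. By Baire, some average moves `z u` by at most `ε / 2` for all `u` in a ball of `W`.
Changing `u` on a final interval of length `η` is small in `L¹`; using the values `x` and `0` there
produces the increment `S(η)x - x` as a difference of two values of `z`. So averaging moves this
increment by at most `ε`, uniformly for `‖x‖ ≤ 1` (`exists_norm_op_sub_sub_average_le`). The
averaged increment is `O(η)`, which gives norm continuity (`exists_norm_op_sub_le`). Some average is
then invertible with range in `D(A)` (`generator_domain_eq_top`). -/

theorem norm_op_sub_op_le (S : C0Semigroup X) (s t : ℝ≥0) (x : X) :
    ‖S.op s x - S.op t x‖ ≤ ‖S.op (min s t)‖ * ‖S.op (max s t - min s t) x - x‖ := by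
  wlog h : t ≤ s generalizing s t
  · rw [norm_sub_rev, min_comm, max_comm]
    exact this t s (le_of_not_ge h)
  rw [min_eq_right h, max_eq_left h]
  have h1 : S.op s x = S.op t (S.op (s - t) x) := by
    conv_lhs => rw [← add_tsub_cancel_of_le h, S.op_add]
    rfl
  rw [h1, ← map_sub]
  exact (S.op t).le_opNorm _

theorem generator_domain_subset_favardSpace (S : C0Semigroup X) :
    (S.generator.domain : Set X) ⊆ S.favardSpace := by
  rintro x ⟨y, hy⟩
  have h1 : Tendsto (fun t : ℝ≥0 => ENNReal.ofReal (‖S.op t x - x‖ / (t : ℝ))) (𝓝[>] 0)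
      (𝓝 (ENNReal.ofReal ‖y‖)) := by
    refine (ENNReal.continuous_ofReal.tendsto _).comp (hy.norm.congr fun t => ?_)
    rw [quot, norm_smul, norm_inv, Complex.norm_real, Real.norm_of_nonneg t.coe_nonneg,
      div_eq_inv_mul]
  change limsup _ _ < ∞
  rw [h1.limsup_eq]
  exact ENNReal.ofReal_lt_top

theorem norm_integral_op_le (S : C0Semigroup X) {h : ℝ≥0} {M : ℝ}
    (hM : ∀ t ≤ h, ‖S.op t‖ ≤ M) (x : X) :
    ‖∫ s in (0 : ℝ)..h, S.op s.toNNReal x‖ ≤ M * h * ‖x‖ := by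
  have h1 := intervalIntegral.norm_integral_le_of_norm_le_const (a := (0 : ℝ)) (b := h)
    (f := fun s => S.op s.toNNReal x) (C := M * ‖x‖) fun s hs => by
      rw [Set.uIoc_of_le h.coe_nonneg] at hs
      refine ((S.op _).le_opNorm x).trans ?_
      gcongr
      exact hM _ (Real.toNNReal_le_iff_le_coe.2 hs.2)
  rwa [sub_zero, abs_of_nonneg h.coe_nonneg, mul_right_comm] at h1

variable [CompleteSpace X]

/-- A strongly continuous semigroup is bounded on bounded time intervals. -/
theorem exists_norm_op_le (S : C0Semigroup X) (T : ℝ≥0) :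
    ∃ M : ℝ, 1 ≤ M ∧ ∀ t ≤ T, ‖S.op t‖ ≤ M := by
  obtain ⟨M, hM⟩ := S.eventually_norm_op_le
  obtain ⟨δ, hδ, hM⟩ := (nhds_bot_basis.eventually_iff (α := ℝ≥0)).1 hM
  have hδ' : (0 : ℝ≥0) < δ := hδ
  set N := max M 1
  have h1 : ∀ n : ℕ, ∀ t : ℝ≥0, t ≤ n * (δ / 2) → ‖S.op t‖ ≤ N ^ n := by
    intro n
    induction n with
    | zero =>
      intro t ht
      have : t = 0 := by simpa using ht
      subst this
      rw [S.op_zero, pow_zero]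
      exact ContinuousLinearMap.norm_id_le
    | succ n ih =>
      intro t ht
      -- Peel off one step of length at most `δ / 2`, which lies strictly inside the neighbourhood
      -- `t < δ`. Truncated subtraction covers `t < δ / 2`.
      have h2 : t = min t (δ / 2) + (t - δ / 2) := by
        rcases le_total t (δ / 2) with h | h
        · simp [tsub_eq_zero_of_le h, h]
        · rw [min_eq_right h, add_tsub_cancel_of_le h]
      have h3 : t - δ / 2 ≤ n * (δ / 2) := by
        rw [tsub_le_iff_right]
        calc t ≤ _ := ht
          _ = _ := by push_cast; ring
      have h4 : ‖S.op (min t (δ / 2))‖ ≤ N :=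
        (hM (Set.mem_Iio.2 ((min_le_right _ _).trans_lt (half_lt_self hδ')))).trans (le_max_left _ _)
      rw [h2, S.op_add, pow_succ']
      exact (ContinuousLinearMap.opNorm_comp_le _ _).trans
        (mul_le_mul h4 (ih _ h3) (norm_nonneg _) (by positivity))
  obtain ⟨n, hn⟩ := exists_nat_ge (T / (δ / 2))
  refine ⟨N ^ n, one_le_pow₀ (le_max_right _ _), fun t ht => h1 n t (ht.trans ?_)⟩
  exact (div_le_iff₀ (by positivity)).1 hn

theorem continuous_op_apply (S : C0Semigroup X) (x : X) : Continuous fun t => S.op t x := by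
  rw [continuous_iff_continuousAt]
  intro t
  obtain ⟨M, -, hM⟩ := S.exists_norm_op_le t
  have h1 : Tendsto (fun s : ℝ≥0 => max s t - min s t) (𝓝 t) (𝓝 0) := by
    have : Continuous fun s : ℝ≥0 => max s t - min s t := by fun_prop
    simpa using this.tendsto t
  have h2 : Tendsto (fun s : ℝ≥0 => M * ‖S.op (max s t - min s t) x - x‖) (𝓝 t) (𝓝 0) := by
    simpa using ((((S.tendsto_zero x).comp h1).sub_const x).norm).const_mul M
  rw [ContinuousAt, tendsto_iff_norm_sub_tendsto_zero]
  refine squeeze_zero (fun s => norm_nonneg _) (fun s => ?_) h2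
  exact (S.norm_op_sub_op_le s t x).trans (by gcongr; exact hM _ (min_le_right _ _))

/-- A strongly continuous semigroup is jointly continuous in time and space. -/
theorem continuous_uncurry_op (S : C0Semigroup X) :
    Continuous fun p : ℝ≥0 × X => S.op p.1 p.2 := by
  rw [continuous_iff_continuousAt]
  rintro ⟨t, x⟩
  obtain ⟨M, -, hM⟩ := S.exists_norm_op_le (t + 1)
  have h1 : Tendsto (fun p : ℝ≥0 × X => M * ‖p.2 - x‖ + ‖S.op p.1 x - S.op t x‖)
      (𝓝 (t, x)) (𝓝 0) := by
    have h2 : Continuous fun p : ℝ≥0 × X => M * ‖p.2 - x‖ + ‖S.op p.1 x - S.op t x‖ := by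
      have := (S.continuous_op_apply x).comp (continuous_fst (X := ℝ≥0) (Y := X))
      simp only [Function.comp_def] at this
      fun_prop
    simpa using h2.tendsto (t, x)
  rw [ContinuousAt, tendsto_iff_norm_sub_tendsto_zero]
  refine squeeze_zero' (Eventually.of_forall fun s => norm_nonneg _) ?_ h1
  have h3 : ∀ᶠ p : ℝ≥0 × X in 𝓝 (t, x), p.1 < t + 1 :=
    continuous_fst.continuousAt.eventually (eventually_lt_nhds (by simp))
  filter_upwards [h3] with p hp
  have h4 : S.op p.1 p.2 - S.op t x = S.op p.1 (p.2 - x) + (S.op p.1 x - S.op t x) := by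
    rw [map_sub]; abel
  rw [h4]
  refine (norm_add_le _ _).trans ?_
  gcongr
  exact ((S.op p.1).le_opNorm _).trans (by gcongr; exact hM _ hp.le)

theorem continuous_op_toNNReal (S : C0Semigroup X) (x : X) :
    Continuous fun t : ℝ => S.op t.toNNReal x :=
  (S.continuous_op_apply x).comp continuous_real_toNNReal

/-- The operator `x ↦ ∫_0^h S(s) x ds`. -/
def integralOp (S : C0Semigroup X) (h : ℝ≥0) : X →L[ℂ] X :=
  LinearMap.mkContinuousOfExistsBound
    { toFun := fun x => ∫ s in (0 : ℝ)..h, S.op s.toNNReal x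
      map_add' := fun x y => by
        simp only [map_add]
        exact intervalIntegral.integral_add ((S.continuous_op_toNNReal x).intervalIntegrable _ _)
          ((S.continuous_op_toNNReal y).intervalIntegrable _ _)
      map_smul' := fun c x => by
        simp only [map_smul]
        exact intervalIntegral.integral_smul c _ } <| by
    obtain ⟨M, -, hM⟩ := S.exists_norm_op_le h
    exact ⟨M * h, S.norm_integral_op_le hM⟩

theorem integralOp_apply (S : C0Semigroup X) (h : ℝ≥0) (x : X) :
    S.integralOp h x = ∫ s in (0 : ℝ)..h, S.op s.toNNReal x := rfl

theorem op_integralOp (S : C0Semigroup X) (r h : ℝ≥0) (x : X) :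
    S.op r (S.integralOp h x) = S.integralOp h (S.op r x) := by
  rw [integralOp_apply, integralOp_apply, ← ContinuousLinearMap.intervalIntegral_comp_comm]
  · simp only [S.op_comm r]
  · exact (S.continuous_op_toNNReal x).intervalIntegrable _ _

theorem integralOp_add (S : C0Semigroup X) (r h : ℝ≥0) (x : X) :
    S.integralOp (r + h) x = S.integralOp r x + S.op r (S.integralOp h x) := by
  have h1 : S.op r (S.integralOp h x) = ∫ s in (r : ℝ)..(r + h : ℝ≥0), S.op s.toNNReal x := by
    rw [integralOp_apply, ← ContinuousLinearMap.intervalIntegral_comp_comm]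
    · have h2 := intervalIntegral.integral_comp_add_left (a := (0 : ℝ)) (b := h)
        (fun s => S.op s.toNNReal x) (r : ℝ)
      rw [add_zero] at h2
      rw [NNReal.coe_add, ← h2]
      refine intervalIntegral.integral_congr fun s hs => ?_
      rw [Set.uIcc_of_le h.coe_nonneg] at hs
      change S.op r (S.op s.toNNReal x) = S.op ((r : ℝ) + s).toNNReal x
      rw [Real.toNNReal_add r.coe_nonneg hs.1, Real.toNNReal_coe, S.op_add]
      rfl
    · exact (S.continuous_op_toNNReal x).intervalIntegrable _ _
  rw [h1, integralOp_apply, integralOp_apply, intervalIntegral.integral_add_adjacent_intervals]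
  all_goals exact (S.continuous_op_toNNReal x).intervalIntegrable _ _

/-- Splitting `∫_0^(r+h)` at `r` or at `h` gives the same total. The exchange of `r` and `h` puts
integrals into `D(A)` and later makes averaged increments `O(η)`. -/
theorem op_integralOp_sub (S : C0Semigroup X) (r h : ℝ≥0) (x : X) :
    S.op r (S.integralOp h x) - S.integralOp h x = S.op h (S.integralOp r x) - S.integralOp r x := by
  rw [sub_eq_sub_iff_add_eq_add, add_comm, ← S.integralOp_add, add_comm r, S.integralOp_add,
    add_comm]

/-- The averages `h⁻¹ ∫_0^h S(s) ds`. -/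
def average (S : C0Semigroup X) (h : ℝ≥0) : X →L[ℂ] X := ((h : ℝ) : ℂ)⁻¹ • S.integralOp h

theorem average_apply (S : C0Semigroup X) (h : ℝ≥0) (x : X) :
    S.average h x = ((h : ℝ) : ℂ)⁻¹ • S.integralOp h x := rfl

theorem tendsto_average (S : C0Semigroup X) (x : X) :
    Tendsto (fun h => S.average h x) (𝓝[>] 0) (𝓝 x) := by
  have h1 := ((S.continuous_op_toNNReal x).integral_hasStrictDerivAt 0 0).hasDerivAt
  rw [hasDerivAt_iff_tendsto_slope_zero] at h1
  have h2 : Tendsto (fun h : ℝ≥0 => (h : ℝ)) (𝓝[>] 0) (𝓝[≠] 0) := by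
    refine tendsto_nhdsWithin_iff.2 ⟨?_, ?_⟩
    · exact (NNReal.continuous_coe.tendsto' 0 0 rfl).mono_left nhdsWithin_le_nhds
    · filter_upwards [self_mem_nhdsWithin] with h hh
      exact (NNReal.coe_pos.2 hh).ne'
  have h3 := h1.comp h2
  rw [Real.toNNReal_zero, S.op_zero] at h3
  refine Tendsto.congr (fun h => ?_) h3
  simp only [Function.comp_apply, zero_add, intervalIntegral.integral_same, sub_zero,
    average_apply, integralOp_apply]
  rw [← Complex.ofReal_inv, Complex.coe_smul]

theorem quot_integralOp (S : C0Semigroup X) (r h : ℝ≥0) (x : X) :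
    S.quot (S.integralOp h x) r = S.op h (S.average r x) - S.average r x := by
  rw [quot, op_integralOp_sub, average_apply, map_smul, smul_sub]

theorem tendsto_quot_integralOp (S : C0Semigroup X) (h : ℝ≥0) (x : X) :
    Tendsto (S.quot (S.integralOp h x)) (𝓝[>] 0) (𝓝 (S.op h x - x)) := by
  have h1 := S.tendsto_average x
  exact ((((S.op h).continuous.tendsto x).comp h1).sub h1).congr
    fun r => (S.quot_integralOp r h x).symm

theorem integralOp_mem_domain (S : C0Semigroup X) (h : ℝ≥0) (x : X) :
    S.integralOp h x ∈ S.generator.domain := ⟨_, S.tendsto_quot_integralOp h x⟩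

/-- The fundamental theorem of calculus for orbits starting in `D(A)`. -/
theorem integralOp_generator (S : C0Semigroup X) (h : ℝ≥0) (x : S.generator.domain) :
    S.integralOp h (S.generator x) = S.op h x - x := by
  have h1 := ((S.integralOp h).continuous.tendsto _).comp (S.tendsto_generator x)
  refine tendsto_nhds_unique (h1.congr fun r => ?_) (S.tendsto_quot_integralOp h x)
  simp only [Function.comp_apply, quot, map_smul, map_sub, op_integralOp]

/-- `∫_0^h S(s) ds` is bounded from `X` with the norm `‖R(λ, A) ·‖` to `X`. -/
theorem exists_norm_integralOp_le (S : C0Semigroup X) (lam : S.resolventSet) (h : ℝ≥0) :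
    ∃ C : ℝ, 0 ≤ C ∧ ∀ x, ‖S.integralOp h x‖ ≤ C * ‖S.resolvent lam x‖ := by
  refine ⟨‖(lam : ℂ)‖ * ‖S.integralOp h‖ + (‖S.op h‖ + 1), by positivity, fun x => ?_⟩
  obtain ⟨h1, h2⟩ := (S.isResolvent lam).1 x
  have h3 := S.integralOp_generator h ⟨_, h1⟩
  -- Write `x = (λ - A) R x` and integrate the orbit of `A R x` exactly.
  have h4 : S.integralOp h x = (lam : ℂ) • S.integralOp h (S.resolvent lam x) -
      (S.op h (S.resolvent lam x) - S.resolvent lam x) := by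
    rw [← h3, ← map_smul, ← map_sub, h2]
  rw [h4, add_mul, add_mul, one_mul]
  refine (norm_sub_le _ _).trans (add_le_add ?_ ((norm_sub_le _ _).trans ?_))
  · rw [norm_smul, mul_assoc]
    gcongr
    exact (S.integralOp h).le_opNorm _
  · gcongr
    exact (S.op h).le_opNorm _

theorem exists_norm_average_le (S : C0Semigroup X) (lam : S.resolventSet) (h : ℝ≥0) :
    ∃ C : ℝ, 0 ≤ C ∧ ∀ x, ‖S.average h x‖ ≤ C * ‖S.embed lam x‖ := by
  obtain ⟨C, hC, h1⟩ := S.exists_norm_integralOp_le lam h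
  refine ⟨‖((h : ℝ) : ℂ)⁻¹‖ * C, by positivity, fun x => ?_⟩
  rw [average_apply, norm_smul, norm_embed, mul_assoc]
  gcongr
  exact h1 x

/-- If `S` is norm continuous at `0`, then its generator is everywhere defined. -/
theorem generator_domain_eq_top (S : C0Semigroup X) {b : ℝ≥0} (hb : 0 < b)
    (hS : ∀ t ≤ b, ∀ x, ‖S.op t x - x‖ ≤ 1 / 2 * ‖x‖) : S.generator.domain = ⊤ := by
  have h1 : ∀ x, ‖S.average b x - x‖ ≤ 1 / 2 * ‖x‖ := by
    intro x
    have hb' : ((b : ℝ) : ℂ) ≠ 0 := by exact_mod_cast hb.ne'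
    have h2 : S.average b x - x =
        ((b : ℝ) : ℂ)⁻¹ • ∫ s in (0 : ℝ)..b, (S.op s.toNNReal x - x) := by
      rw [intervalIntegral.integral_sub ((S.continuous_op_toNNReal x).intervalIntegrable _ _)
        (continuous_const.intervalIntegrable _ _), intervalIntegral.integral_const, sub_zero,
        smul_sub, average_apply, integralOp_apply, ← Complex.coe_smul (b : ℝ) x,
        inv_smul_smul₀ hb']
    have h3 := intervalIntegral.norm_integral_le_of_norm_le_const (a := (0 : ℝ)) (b := b)
      (f := fun s => S.op s.toNNReal x - x) (C := 1 / 2 * ‖x‖) fun s hs => by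
        rw [Set.uIoc_of_le b.coe_nonneg] at hs
        exact hS _ (Real.toNNReal_le_iff_le_coe.2 hs.2) x
    rw [sub_zero, abs_of_nonneg b.coe_nonneg] at h3
    rw [h2, norm_smul, norm_inv, Complex.norm_real, Real.norm_of_nonneg b.coe_nonneg,
      inv_mul_le_iff₀ (NNReal.coe_pos.2 hb), mul_comm (b : ℝ)]
    exact h3
  have h2 : ‖1 - S.average b‖ < 1 := by
    refine (ContinuousLinearMap.opNorm_le_bound _ (by norm_num : (0 : ℝ) ≤ 1 / 2)
      fun x => ?_).trans_lt (by norm_num)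
    rw [← norm_neg]
    simpa using h1 x
  -- Neumann series: the average is invertible, so its range, contained in `D(A)`, is all of `X`.
  obtain ⟨e, he⟩ := isUnit_one_sub_of_norm_lt_one h2
  rw [sub_sub_cancel] at he
  refine eq_top_iff.2 fun x _ => ?_
  have h3 : S.average b ((↑e⁻¹ : X →L[ℂ] X) x) = x := by
    rw [← he]
    exact DFunLike.congr_fun e.mul_inv x
  rw [← h3, average_apply]
  exact Submodule.smul_mem _ _ (S.integralOp_mem_domain b _)

end Averages

/-! ### Control integrals and the Baire category argument. -/

section Admissibility

variable {X U : Type*} [NormedAddCommGroup X] [NormedSpace ℂ X] [CompleteSpace X]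
  [NormedAddCommGroup U] [NormedSpace ℂ U]

theorem intervalIntegrable_op_comp (S : C0Semigroup X) (B : U →L[ℂ] X) {τ : ℝ} (hτ : 0 ≤ τ)
    {u : ℝ → U} (hu : Integrable u (volume.restrict (Set.Icc 0 τ))) :
    IntervalIntegrable (fun t => S.op (τ - t).toNNReal (B (u t))) volume 0 τ := by
  rw [intervalIntegrable_iff_integrableOn_Icc_of_le hτ]
  obtain ⟨M, -, hM⟩ := S.exists_norm_op_le τ.toNNReal
  have h1 : Integrable (fun t => B (u t)) (volume.restrict (Set.Icc 0 τ)) :=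
    B.integrable_comp hu
  have h2 : AEStronglyMeasurable (fun t : ℝ => (τ - t).toNNReal)
      (volume.restrict (Set.Icc 0 τ)) :=
    (continuous_real_toNNReal.comp (continuous_const.sub continuous_id)).aestronglyMeasurable
  refine Integrable.mono' (h1.norm.const_mul M)
    (S.continuous_uncurry_op.comp_aestronglyMeasurable (h2.prodMk h1.1)) ?_
  filter_upwards [ae_restrict_mem measurableSet_Icc] with t ht
  refine ((S.op _).le_opNorm _).trans ?_
  gcongr
  exact hM _ (Real.toNNReal_le_toNNReal (by linarith [ht.1]))

/-- The control integral is Lipschitz for the `L¹` norm of the input, with constant `M ‖B‖`. It is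
applied to the semigroup on `X₋₁`. -/
theorem exists_norm_integral_op_comp_sub_le (S : C0Semigroup X) (B : U →L[ℂ] X) {τ : ℝ}
    (hτ : 0 ≤ τ) : ∃ C : ℝ≥0, ∀ u w : ℝ → U, Integrable u (volume.restrict (Set.Icc 0 τ)) →
      Integrable w (volume.restrict (Set.Icc 0 τ)) →
      ‖(∫ t in (0 : ℝ)..τ, S.op (τ - t).toNNReal (B (u t))) -
        ∫ t in (0 : ℝ)..τ, S.op (τ - t).toNNReal (B (w t))‖ ≤
        C * ∫ t in Set.Icc 0 τ, ‖u t - w t‖ := by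
  obtain ⟨M, hM1, hM⟩ := S.exists_norm_op_le τ.toNNReal
  refine ⟨M.toNNReal * ‖B‖₊, fun u w hu hw => ?_⟩
  rw [← intervalIntegral.integral_sub (S.intervalIntegrable_op_comp B hτ hu)
    (S.intervalIntegrable_op_comp B hτ hw), ← integral_const_mul,
    intervalIntegral.integral_of_le hτ, ← integral_Icc_eq_integral_Ioc]
  refine norm_integral_le_of_norm_le ((hu.sub hw).norm.const_mul _) ?_
  filter_upwards [ae_restrict_mem measurableSet_Icc] with t ht
  rw [← map_sub, ← map_sub]
  refine ((S.op _).le_opNorm _).trans ?_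
  rw [NNReal.coe_mul, Real.coe_toNNReal _ (zero_le_one.trans hM1), coe_nnnorm, mul_assoc]
  refine mul_le_mul (hM _ (Real.toNNReal_le_toNNReal (by linarith [ht.1]))) (B.le_opNorm _)
    (norm_nonneg _) (zero_le_one.trans hM1)

/-- After the substitution `s = τ - t` this is the fundamental theorem of calculus in `X₋₁`, where
every `x ∈ X` lies in the domain of the generator. The choice `B = A₋₁` enters here. -/
theorem integral_indicator_extrapolatedGenerator (S : C0Semigroup X) (lam : S.resolventSet)
    {τ : ℝ} {η : ℝ≥0} (hη : η ≤ τ) (x : X) :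
    ∫ t in (0 : ℝ)..τ, (S.extrapolated lam).op (τ - t).toNNReal
      (S.extrapolatedGenerator lam ((Set.Ioi (τ - η)).indicator (fun _ => x) t)) =
      S.embed lam (S.op η x - x) := by
  set T := S.extrapolated lam
  set y := S.extrapolatedGenerator lam x
  have h1 : (fun t => T.op (τ - t).toNNReal
      (S.extrapolatedGenerator lam ((Set.Ioi (τ - η)).indicator (fun _ => x) t))) =
      (Set.Ioi (τ - η)).indicator fun t => T.op (τ - t).toNNReal y := by
    ext t
    by_cases ht : t ∈ Set.Ioi (τ - η) <;> simp [ht, y]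
  have hτ : 0 ≤ τ := η.coe_nonneg.trans hη
  rw [h1, intervalIntegral.integral_of_le hτ, integral_indicator measurableSet_Ioi,
    Measure.restrict_restrict measurableSet_Ioi, Set.inter_comm, Set.Ioc_inter_Ioi,
    max_eq_right (sub_nonneg.2 hη), ← intervalIntegral.integral_of_le (by simp),
    intervalIntegral.integral_comp_sub_left (fun s => T.op s.toNNReal y), sub_self, sub_sub_cancel,
    ← T.integralOp_apply]
  refine (T.integralOp_generator η ⟨S.embed lam x, S.embed_mem_domain lam x⟩).trans ?_
  rw [map_sub, ← extrapolatedOp_embed]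
  rfl

/-- By the Baire category theorem, admissibility makes the averages `h⁻¹ ∫_0^h S(s) ds` uniformly
close to the identity on the increments `S(η)x - x`. -/
theorem exists_norm_op_sub_sub_average_le (S : C0Semigroup X) (lam : S.resolventSet)
    (hadm : S.IsLinftyAdmissible lam (S.extrapolatedGenerator lam)) {ε : ℝ} (hε : 0 < ε) :
    ∃ h : ℝ≥0, 0 < h ∧ ∃ η₀ : ℝ≥0, 0 < η₀ ∧ ∀ η ≤ η₀, ∀ x : X, ‖x‖ ≤ 1 →
      ‖(S.op η x - x) - S.average h (S.op η x - x)‖ ≤ ε := by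
  obtain ⟨τ, hτ, hadm⟩ := hadm
  set μ := volume.restrict (Set.Icc 0 τ)
  set B := S.extrapolatedGenerator lam
  set T := S.extrapolated lam
  let Φ : (ℝ → X) → S.ExtrapolationSpace lam :=
    fun u => ∫ t in (0 : ℝ)..τ, T.op (τ - t).toNNReal (B (u t))
  obtain ⟨C, hC⟩ := T.exists_norm_integral_op_comp_sub_le B hτ.le
  have hΦ : Continuous fun u : Lp X 1 μ => Φ u := by
    refine (LipschitzWith.of_dist_le_mul (K := C) fun u w => ?_).continuous
    rw [dist_eq_norm, L1.dist_eq_integral_dist]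
    simp only [dist_eq_norm]
    exact hC u w (L1.integrable_coeFn u) (L1.integrable_coeFn w)
  -- With the `L¹` metric, unlike that of `L^∞`, bounded changes on short intervals are small;
  -- closedness of `W` keeps the space complete for Baire.
  let W : Set (Lp X 1 μ) := {u | ∀ᵐ t ∂μ, ‖u t‖ ≤ 1}
  have hW : IsClosed W := by
    refine IsSeqClosed.isClosed fun u w hu huw => ?_
    obtain ⟨ns, -, hns⟩ := (tendstoInMeasure_of_tendsto_Lp huw).exists_seq_tendsto_ae
    filter_upwards [hns, ae_all_iff.2 hu] with t ht1 ht2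
    exact le_of_tendsto ht1.norm (Eventually.of_forall fun n => ht2 _)
  have hWz : ∀ u : W, ∃ z, S.embed lam z = Φ u := fun u =>
    hadm _ (memLp_top_of_bound (Lp.aestronglyMeasurable _) 1 u.2)
  choose z hz using hWz
  have hcont : ∀ h, Continuous fun u : W => S.average h (z u) := by
    intro h
    obtain ⟨K, hK0, hK⟩ := S.exists_norm_average_le lam h
    rw [continuous_iff_continuousAt]
    intro u
    rw [ContinuousAt, tendsto_iff_norm_sub_tendsto_zero]
    have h1 : Tendsto (fun w : W => K * ‖Φ w - Φ u‖) (𝓝 u) (𝓝 0) := by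
      simpa using (((hΦ.comp continuous_subtype_val).tendsto u).sub_const (Φ u)).norm.const_mul K
    refine squeeze_zero (fun w => norm_nonneg _) (fun w => ?_) h1
    rw [← hz, ← hz, ← map_sub, ← map_sub]
    exact hK _
  let r : ℕ → ℝ≥0 := fun n => 1 / ((n : ℝ≥0) + 1)
  have hr0 : ∀ n, 0 < r n := fun n => by positivity
  have hr : Tendsto r atTop (𝓝[>] 0) :=
    tendsto_nhdsWithin_iff.2 ⟨tendsto_one_div_add_atTop_nhds_zero_nat, Eventually.of_forall hr0⟩
  have hlim : ∀ u, Tendsto (fun n => S.average (r n) (z u)) atTop (𝓝 (z u)) := fun u =>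
    (S.tendsto_average (z u)).comp hr
  let F : ℕ → Set W := fun n =>
    {u | ∀ m ≥ n, ‖S.average (r m) (z u) - S.average (r n) (z u)‖ ≤ ε / 2}
  have hF : ∀ n, IsClosed (F n) := fun n => by
    simp only [F, Set.ofPred_forall]
    exact isClosed_iInter fun m => isClosed_iInter fun _ =>
      isClosed_le ((hcont _).sub (hcont _)).norm continuous_const
  have hFU : ⋃ n, F n = Set.univ := by
    refine Set.eq_univ_of_forall fun u => Set.mem_iUnion.2 ?_
    obtain ⟨n, hn⟩ := Metric.cauchySeq_iff'.1 (hlim u).cauchySeq (ε / 2) (half_pos hε)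
    exact ⟨n, fun m hm => by simpa [dist_eq_norm] using (hn m hm).le⟩
  have : CompleteSpace W := hW.completeSpace_coe
  have : Nonempty W := ⟨0, by
    change ∀ᵐ t ∂μ, ‖(0 : Lp X 1 μ) t‖ ≤ 1
    filter_upwards [Lp.coeFn_zero X 1 μ] with t ht
    rw [ht]
    simp⟩
  obtain ⟨n, u₀, hu₀⟩ := nonempty_interior_of_iUnion_of_closed hF hFU
  obtain ⟨ρ, hρ, hball⟩ := Metric.isOpen_iff.1 isOpen_interior u₀ hu₀
  -- Let `m → ∞` in the condition defining `F n`.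
  have hclose : ∀ u : W, dist u u₀ < ρ → ‖z u - S.average (r n) (z u)‖ ≤ ε / 2 := by
    intro u hu
    refine le_of_tendsto ((hlim u).sub_const _).norm ?_
    filter_upwards [eventually_ge_atTop n] with m hm
    exact interior_subset (hball hu) m hm
  -- A change of size at most `2` on a set of measure `η ≤ ρ / 4` costs at most `ρ / 2 < ρ` in `L¹`;
  -- `η ≤ τ` keeps that set inside `[0, τ]`.
  refine ⟨r n, hr0 n, min τ.toNNReal (ρ / 4).toNNReal, by simp [hτ, hρ], fun η hη x hx => ?_⟩
  have hητ : (η : ℝ) ≤ τ := by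
    rw [← Real.le_toNNReal_iff_coe_le hτ.le]; exact hη.trans (min_le_left _ _)
  have hηρ : (η : ℝ) ≤ ρ / 4 := by
    rw [← Real.le_toNNReal_iff_coe_le (by positivity)]; exact hη.trans (min_le_right _ _)
  /- Replace `u₀` by the constant `v` on the last piece of length `η`. -/
  have hmod : ∀ v : X, ‖v‖ ≤ 1 → ∃ w : W, dist w u₀ < ρ ∧
      (w : ℝ → X) =ᵐ[μ] fun t => (Set.Ioi (τ - η)).piecewise (fun _ => v) (u₀ : ℝ → X) t := by
    intro v hv
    have hu₀i : Integrable (u₀ : ℝ → X) μ := L1.integrable_coeFn _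
    have hi : Integrable ((Set.Ioi (τ - η)).piecewise (fun _ => v) (u₀ : ℝ → X)) μ :=
      Integrable.piecewise measurableSet_Ioi (integrable_const v).integrableOn
        hu₀i.integrableOn
    have hwe := hi.coeFn_toL1
    refine ⟨⟨hi.toL1 _, ?_⟩, ?_, hwe⟩
    · change ∀ᵐ t ∂μ, ‖hi.toL1 _ t‖ ≤ 1
      filter_upwards [hwe, u₀.2] with t ht1 ht2
      rw [ht1]
      by_cases ht : t ∈ Set.Ioi (τ - η)
      · rwa [Set.piecewise_eq_of_mem _ _ _ ht]
      · rwa [Set.piecewise_eq_of_notMem _ _ _ ht]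
    · rw [Subtype.dist_eq, L1.dist_eq_integral_dist]
      have h1 : ∫ t, dist (hi.toL1 _ t) ((u₀ : Lp X 1 μ) t) ∂μ ≤
          ∫ t, (Set.Ioi (τ - η)).indicator (fun _ => (2 : ℝ)) t ∂μ := by
        refine integral_mono_ae (((L1.integrable_coeFn (hi.toL1 _)).sub hu₀i).norm.congr ?_)
          ((integrable_const _).indicator measurableSet_Ioi) ?_
        · exact Eventually.of_forall fun t => (dist_eq_norm _ _).symm
        · filter_upwards [hwe, u₀.2] with t ht1 ht2
          rw [ht1, dist_eq_norm]
          by_cases ht : t ∈ Set.Ioi (τ - η)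
          · rw [Set.piecewise_eq_of_mem _ _ _ ht, Set.indicator_of_mem ht]
            exact (norm_sub_le _ _).trans (by linarith)
          · rw [Set.piecewise_eq_of_notMem _ _ _ ht, Set.indicator_of_notMem ht]
            simp
      have h2 : ∫ t, (Set.Ioi (τ - η)).indicator (fun _ => (2 : ℝ)) t ∂μ = 2 * η := by
        have h3 : Set.Ioi (τ - η) ∩ Set.Icc 0 τ = Set.Ioc (τ - η) τ ∩ Set.Ici 0 := by
          ext t; simp only [Set.mem_inter_iff, Set.mem_Ioi, Set.mem_Icc, Set.mem_Ioc, Set.mem_Ici]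
          tauto
        have h4 : Set.Ioc (τ - η) τ ∩ Set.Ici 0 = Set.Ioc (τ - η) τ :=
          Set.inter_eq_left.2 fun t ht => by
            have := ht.1
            simp only [Set.mem_Ici]; linarith
        rw [integral_indicator_const _ measurableSet_Ioi, smul_eq_mul, mul_comm,
          measureReal_restrict_apply measurableSet_Ioi, h3, h4]
        simp
      linarith
  obtain ⟨w₁, hw₁, hw₁e⟩ := hmod x hx
  obtain ⟨w₂, hw₂, hw₂e⟩ := hmod 0 (by simp)
  -- The two inputs agree with `u₀` before `τ - η`, so only the constant `x` on the last piece
  -- survives. Injectivity of `embed` brings the identity back to `X`.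
  have hdiff : z w₁ - z w₂ = S.op η x - x := by
    refine (?_ : Function.Injective (S.embed lam)) ?_
    · refine (injective_iff_map_eq_zero _).2 fun v hv => S.resolvent_injective lam ?_
      rw [map_zero, ← norm_eq_zero, ← norm_embed, hv, norm_zero]
    rw [map_sub, hz, hz, ← S.integral_indicator_extrapolatedGenerator lam hητ,
      ← intervalIntegral.integral_sub
        (T.intervalIntegrable_op_comp B hτ.le (L1.integrable_coeFn _))
        (T.intervalIntegrable_op_comp B hτ.le (L1.integrable_coeFn _)),
      intervalIntegral.integral_of_le hτ.le, intervalIntegral.integral_of_le hτ.le,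
      ← integral_Icc_eq_integral_Ioc, ← integral_Icc_eq_integral_Ioc]
    refine integral_congr_ae ?_
    filter_upwards [hw₁e, hw₂e] with t ht1 ht2
    rw [← map_sub, ← map_sub, ht1, ht2]
    by_cases ht : t ∈ Set.Ioi (τ - η)
    · simp [Set.piecewise_eq_of_mem _ _ _ ht, Set.indicator_of_mem ht, T, B]
    · simp [Set.piecewise_eq_of_notMem _ _ _ ht, Set.indicator_of_notMem ht]
  rw [← hdiff, map_sub, sub_sub_sub_comm]
  refine (norm_sub_le _ _).trans ?_
  linarith [hclose w₁ hw₁, hclose w₂ hw₂]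

/-- If `A₋₁` is `L^∞`-admissible, then `S` is norm continuous at `0`. -/
theorem exists_norm_op_sub_le (S : C0Semigroup X) (lam : S.resolventSet)
    (hadm : S.IsLinftyAdmissible lam (S.extrapolatedGenerator lam)) {ε : ℝ} (hε : 0 < ε) :
    ∃ b : ℝ≥0, 0 < b ∧ ∀ t ≤ b, ∀ x : X, ‖S.op t x - x‖ ≤ ε * ‖x‖ := by
  obtain ⟨h, hh, η₀, hη₀, H⟩ := S.exists_norm_op_sub_sub_average_le lam hadm (half_pos hε)
  obtain ⟨M, hM1, hM⟩ := S.exists_norm_op_le (h + η₀)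
  have hM0 : 0 < M := one_pos.trans_le hM1
  have hh' : (0 : ℝ) < h := hh
  -- Chosen so that `h⁻¹ (M * (M * t) + M * t) ≤ ε / 2` for `t ≤ c`.
  set c : ℝ≥0 := (ε * h / (2 * (M * (M + 1)))).toNNReal
  have hc : 0 < c := Real.toNNReal_pos.2 (by positivity)
  refine ⟨min η₀ c, lt_min hη₀ hc, fun t ht => ?_⟩
  have hunit : ∀ x : X, ‖x‖ ≤ 1 → ‖S.op t x - x‖ ≤ ε := by
    intro x hx
    have h1 : ‖S.average h (S.op t x - x)‖ ≤ ε / 2 := by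
      -- Exchanging `h` and `t` leaves an integral over `[0, t]`, of size at most `M * t`.
      have h2 : S.integralOp h (S.op t x - x) = S.op h (S.integralOp t x) - S.integralOp t x := by
        rw [map_sub, ← op_integralOp, op_integralOp_sub]
      have h3 : ‖S.integralOp t x‖ ≤ M * t := by
        refine (S.norm_integral_op_le
          (fun s hs => hM s (hs.trans (ht.trans ((min_le_left _ _).trans le_add_self)))) x).trans ?_
        exact mul_le_of_le_one_right (by positivity) hx
      have h4 : (t : ℝ) ≤ ε * h / (2 * (M * (M + 1))) :=
        (Real.le_toNNReal_iff_coe_le (by positivity)).1 (ht.trans (min_le_right _ _))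
      rw [le_div_iff₀ (by positivity)] at h4
      rw [average_apply, norm_smul, norm_inv, Complex.norm_real, Real.norm_of_nonneg hh'.le,
        inv_mul_le_iff₀ hh', h2]
      have h5 : ‖S.op h (S.integralOp t x)‖ ≤ M * (M * t) :=
        ((S.op h).le_opNorm _).trans
          (mul_le_mul (hM _ le_self_add) h3 (norm_nonneg _) hM0.le)
      refine (norm_sub_le _ _).trans ?_
      nlinarith
    have h6 := H t (ht.trans (min_le_left _ _)) x hx
    have h7 := norm_add_le ((S.op t x - x) - S.average h (S.op t x - x))
      (S.average h (S.op t x - x))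
    rw [sub_add_cancel] at h7
    linarith
  have hop : ‖S.op t - ContinuousLinearMap.id ℂ X‖ ≤ ε :=
    ContinuousLinearMap.opNorm_le_of_unit_norm hε.le fun x hx => hunit x hx.le
  exact fun x => ContinuousLinearMap.le_of_opNorm_le _ hop x

end Admissibility

end C0Semigroup

end

theorem theorem2p6 {X : Type*} [NormedAddCommGroup X] [NormedSpace ℂ X] [CompleteSpace X]
    (S : C0Semigroup X) (lam : S.resolventSet)
    (hadm : S.IsLinftyAdmissible lam (S.extrapolatedGenerator lam)) :
    S.favardSpace = (S.generator.domain : Set X) := by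
  obtain ⟨b, hb, hS⟩ := S.exists_norm_op_sub_le lam hadm (half_pos one_pos)
  refine subset_antisymm (fun x _ => ?_) S.generator_domain_subset_favardSpace
  rw [S.generator_domain_eq_top hb hS]
  exact Set.mem_univ x
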